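/- Let $0\le k<n$ and let $h=(h_1,\dots,h_k)$ with $h_j\in\mathbb{R}[x_1,\dots,x_n]$. Let $V=V_{\mathbb R}(h)=\{x\in\mathbb{R}^n : h(x)=0\}$ and let $\mathcal J(x)=(\partial h_j/\partial x_i(x))_{j,i}$ be the $k\times n$ Jacobian matrix. Assume that $V\neq\emptyset$ and that $\mathcal J(x)$ has rank $k$ at every $x\in V$. Then $V$ is an embedded smooth submanifold of $\mathbb{R}^n$ of dimension $n-k$, and $V$ has a tubular neighborhood $U$ such that the following holds for every $b\in U$: (1) there is a unique point $x_b\in V$ of minimum Euclidean distance to $b$; (2) there is $\lambda_b\in\mathbb{R}^k$ such that $(x_b,\lambda_b)$ is an isolated and simple zero of the Lagrange system $$x-b=\mathcal J(x)^{t}\lambda,\qquad h(x)=0$$ of the problem $\min \|x-b\|_2^2/2$ subject to $h(x)=0$, and $(x_b,\lambda_b)$ is the only zero of this system, real or complex, whose $x$-component is $x_b$. Here a tubular neighborhood of $V$ is an open set $U\supseteq V$ that is the diffeomorphic image, under $E(x,v)=x+v$, of a set $\{(x,v)\in NV : \|v\|_2<\delta(x)\}$ for some positive continuous function $\delta:V\to\mathbb{R}$,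 where $NV=\{(x,v): x\in V,\ v\perp T_xV\}$ is the normal bundle of $V$. The zero is isolated if it has a neighborhood in $\mathbb{C}^{n}\times\mathbb{C}^{k}$ (hence also one in $\mathbb{R}^n\times\mathbb{R}^k$) that contains no other zero of the system, and simple if the $(n+k)\times(n+k)$ Jacobian matrix of the system with respect to $(x,\lambda)$ is nonsingular there. -/

import Mathlib

open scoped ContDiff

namespace TubularLagrange

section Smooth

variable {X Y : Type*} [NormedAddCommGroup X] [NormedSpace ℝ X]
  [NormedAddCommGroup Y] [NormedSpace ℝ Y]

/-- Smoothness of a map on an arbitrary subset `A` of a normed space: near every point of `A`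
it agrees on `A` with a smooth map defined on an open subset of the ambient space. -/
def SmoothOnSubset (f : X → Y) (A : Set X) : Prop :=
  ∀ x ∈ A, ∃ O : Set X, IsOpen O ∧ x ∈ O ∧
    ∃ g : X → Y, ContDiffOn ℝ ∞ g O ∧ Set.EqOn f g (A ∩ O)

/-- `f` restricts to a diffeomorphism from the subset `A` onto the subset `B`. -/
def IsDiffeoOnto (f : X → Y) (A : Set X) (B : Set Y) : Prop :=
  Set.BijOn f A B ∧ SmoothOnSubset f A ∧
    ∃ g : Y → X, Set.InvOn g f A B ∧ SmoothOnSubset g B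

end Smooth

section Submanifold

variable {n : ℕ}

/-- `M` is an embedded smooth submanifold of dimension `d` of `ℝⁿ`: around each of its points
there is a smooth chart of `ℝⁿ` that carries `M` to a `d`-dimensional linear slice. -/
def IsEmbeddedSubmanifold (d : ℕ) (M : Set (EuclideanSpace ℝ (Fin n))) : Prop :=
  ∀ x ∈ M, ∃ φ : OpenPartialHomeomorph (EuclideanSpace ℝ (Fin n)) (EuclideanSpace ℝ (Fin n)),
    x ∈ φ.source ∧ ContDiffOn ℝ ∞ φ φ.source ∧ ContDiffOn ℝ ∞ φ.symm φ.target ∧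
    ∃ W : Submodule ℝ (EuclideanSpace ℝ (Fin n)), Module.finrank ℝ W = d ∧
      ∀ y ∈ φ.source, y ∈ M ↔ φ y ∈ W

/-- Tangent vectors to `M` at `x`: velocities at time `0` of smooth curves in `M` through `x`. -/
def tangentVectors (M : Set (EuclideanSpace ℝ (Fin n))) (x : EuclideanSpace ℝ (Fin n)) :
    Set (EuclideanSpace ℝ (Fin n)) :=
  {v | ∃ (ε : ℝ) (γ : ℝ → EuclideanSpace ℝ (Fin n)), 0 < ε ∧
    ContDiffOn ℝ ∞ γ (Set.Ioo (-ε) ε) ∧ (∀ t ∈ Set.Ioo (-ε) ε, γ t ∈ M) ∧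
    γ 0 = x ∧ HasDerivAt γ v 0}

/-- The normal bundle of `M`: the pairs `(x, v)` with `x ∈ M` and `v` orthogonal to every
tangent vector of `M` at `x`. -/
def normalBundle (M : Set (EuclideanSpace ℝ (Fin n))) :
    Set (EuclideanSpace ℝ (Fin n) × EuclideanSpace ℝ (Fin n)) :=
  {p | p.1 ∈ M ∧ ∀ w ∈ tangentVectors M p.1, inner ℝ p.2 w = 0}

/-- `U` is a tubular neighborhood of `M`: an open neighborhood of `M` that is the diffeomorphic
image under `(x, v) ↦ x + v` of `{(x, v) ∈ NM | ‖v‖ < δ x}`, for some positive continuous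
function `δ` on `M`. -/
def IsTubularNeighborhood (M U : Set (EuclideanSpace ℝ (Fin n))) : Prop :=
  IsOpen U ∧ M ⊆ U ∧
    ∃ δ : EuclideanSpace ℝ (Fin n) → ℝ, ContinuousOn δ M ∧ (∀ x ∈ M, 0 < δ x) ∧
      IsDiffeoOnto
        (fun p : EuclideanSpace ℝ (Fin n) × EuclideanSpace ℝ (Fin n) => p.1 + p.2)
        {p | p ∈ normalBundle M ∧ ‖p.2‖ < δ p.1} U

/-- `x` is a point of `M` at minimum distance from `b`. -/
def IsNearestPoint (M : Set (EuclideanSpace ℝ (Fin n))) (b x : EuclideanSpace ℝ (Fin n)) : Prop :=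
  x ∈ M ∧ ∀ y ∈ M, dist b x ≤ dist b y

end Submanifold

section Systems

/-- The real zero set in `ℝⁿ` of a polynomial system. -/
def realZeroSet {n k : ℕ} (h : Fin k → MvPolynomial (Fin n) ℝ) :
    Set (EuclideanSpace ℝ (Fin n)) :=
  {x | ∀ j, MvPolynomial.eval (fun i => x i) (h j) = 0}

/-- The Jacobian matrix of a real polynomial system, evaluated at a point with coordinates in a
commutative `ℝ`-algebra. -/
noncomputable def jacobian {σ τ A : Type*} [CommRing A] [Algebra ℝ A]
    (F : τ → MvPolynomial σ ℝ) (z : σ → A) : Matrix τ σ A :=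
  Matrix.of fun j i => MvPolynomial.aeval z (MvPolynomial.pderiv i (F j))

/-- The Lagrange system of `min ‖x - b‖² / 2` subject to `h x = 0`, as a square polynomial system
in the variables `x` (left) and the multipliers `lam` (right):
`x i - b i - ∑ j, lam j * ∂h j / ∂x i = 0` for all `i`, and `h j x = 0` for all `j`. -/
noncomputable def lagrangeSystem {n k : ℕ} (h : Fin k → MvPolynomial (Fin n) ℝ)
    (b : EuclideanSpace ℝ (Fin n)) :
    Fin n ⊕ Fin k → MvPolynomial (Fin n ⊕ Fin k) ℝ :=
  Sum.elim
    (fun i => MvPolynomial.X (Sum.inl i) - MvPolynomial.C (b i) -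
      ∑ j, MvPolynomial.X (Sum.inr j) *
        MvPolynomial.rename Sum.inl (MvPolynomial.pderiv i (h j)))
    (fun j => MvPolynomial.rename Sum.inl (h j))

/-- `z` is a complex zero of the real polynomial system `F`. -/
def IsComplexZero {σ τ : Type*} (F : τ → MvPolynomial σ ℝ) (z : σ → ℂ) : Prop :=
  ∀ j, MvPolynomial.aeval z (F j) = 0

/-- `z` is an isolated point of the complex zero set of `F`. -/
def IsIsolatedZero {σ τ : Type*} (F : τ → MvPolynomial σ ℝ) (z : σ → ℂ) : Prop :=
  IsComplexZero F z ∧ ∃ O : Set (σ → ℂ), IsOpen O ∧ z ∈ O ∧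
    ∀ z' ∈ O, IsComplexZero F z' → z' = z

/-- `z` is a simple zero of the square system `F`: a zero with nonsingular Jacobian matrix. -/
def IsSimpleZero {σ : Type*} [Fintype σ] [DecidableEq σ] (F : σ → MvPolynomial σ ℝ)
    (z : σ → ℂ) : Prop :=
  IsComplexZero F z ∧ (jacobian F z).det ≠ 0

/-- The point `(x, lam)` with real coordinates, regarded as a complex point. -/
def complexPoint {n k : ℕ} (x : EuclideanSpace ℝ (Fin n)) (lam : Fin k → ℝ) :
    Fin n ⊕ Fin k → ℂ :=
  Sum.elim (fun i => (x i : ℂ)) (fun j => (lam j : ℂ))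

end Systems

end TubularLagrange

open TubularLagrange

namespace TubularLagrange

section PolynomialMaps

variable {σ τ 𝕜 : Type*} [Fintype σ] [NontriviallyNormedField 𝕜] [Algebra ℝ 𝕜]

theorem hasStrictFDerivAt_aeval (p : MvPolynomial σ ℝ) (z : σ → 𝕜) :
    HasStrictFDerivAt (fun z : σ → 𝕜 => MvPolynomial.aeval z p)
      (∑ i, MvPolynomial.aeval z (MvPolynomial.pderiv i p) •
        ContinuousLinearMap.proj (R := 𝕜) (φ := fun _ : σ => 𝕜) i) z := by
  classical
  induction p using MvPolynomial.induction_on with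
  | C a =>
    simp only [MvPolynomial.aeval_C]
    refine (hasStrictFDerivAt_const (𝕜 := 𝕜) (algebraMap ℝ 𝕜 a) z).congr_fderiv ?_
    ext v
    simp
  | add p q hp hq =>
    simp only [map_add]
    refine (hp.fun_add hq).congr_fderiv ?_
    ext v
    simp [add_mul, Finset.sum_add_distrib]
  | mul_X p i hp =>
    have hX : HasStrictFDerivAt (fun z : σ → 𝕜 => z i)
        (ContinuousLinearMap.proj (R := 𝕜) (φ := fun _ : σ => 𝕜) i) z :=
      (ContinuousLinearMap.proj (R := 𝕜) (φ := fun _ : σ => 𝕜) i).hasStrictFDerivAt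
    simp only [map_mul, MvPolynomial.aeval_X]
    refine (hp.fun_mul hX).congr_fderiv ?_
    ext v
    have hs : ∀ j, MvPolynomial.aeval z
        (MvPolynomial.pderiv j (p * MvPolynomial.X i : MvPolynomial σ ℝ)) * v j =
        (if j = i then MvPolynomial.aeval z p * v j else 0) +
          z i * (MvPolynomial.aeval z (MvPolynomial.pderiv j p) * v j) := by
      intro j
      by_cases hj : j = i
      · subst hj
        simp
        ring
      · simp [hj, MvPolynomial.pderiv_X_of_ne (Ne.symm hj)]
        ring
    simp only [add_apply, smul_apply,
      sum_apply, ContinuousLinearMap.proj_apply, smul_eq_mul, hs]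
    simp [Finset.sum_add_distrib, Finset.mul_sum]

/-- A polynomial map is strictly differentiable, with derivative its Jacobian matrix. -/
theorem hasStrictFDerivAt_polyMap [Fintype τ] [CompleteSpace 𝕜] (F : τ → MvPolynomial σ ℝ)
    (z : σ → 𝕜) :
    HasStrictFDerivAt (fun (z : σ → 𝕜) (j : τ) => MvPolynomial.aeval z (F j))
      (LinearMap.toContinuousLinearMap (jacobian F z).mulVecLin) z := by
  rw [hasStrictFDerivAt_pi']
  intro j
  refine (hasStrictFDerivAt_aeval (F j) z).congr_fderiv ?_
  ext v
  simp [jacobian, Matrix.mulVec, dotProduct]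

theorem contDiff_polyMap [Fintype τ] (F : τ → MvPolynomial σ ℝ) :
    ContDiff ℝ ∞ (fun (z : σ → ℝ) (j : τ) => MvPolynomial.aeval z (F j)) := by
  rw [contDiff_pi]
  intro j
  exact contDiff_iff_contDiffAt.2 fun z => (AnalyticAt.aeval_mvPolynomial (f := fun z : σ → ℝ => z)
    (fun i => (ContinuousLinearMap.proj (R := ℝ) (φ := fun _ : σ => ℝ) i).analyticAt z)
    (F j)).contDiffAt

end PolynomialMaps

/-- A matrix with nonzero determinant acts as a continuous linear automorphism. -/
theorem exists_equiv_of_det_ne_zero {σ 𝕜 : Type*} [Fintype σ] [DecidableEq σ]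
    [NontriviallyNormedField 𝕜] [CompleteSpace 𝕜] {M : Matrix σ σ 𝕜} (hM : M.det ≠ 0) :
    ∃ e : (σ → 𝕜) ≃L[𝕜] (σ → 𝕜),
      (e : (σ → 𝕜) →L[𝕜] (σ → 𝕜)) = LinearMap.toContinuousLinearMap M.mulVecLin := by
  have hu : IsUnit M := (Matrix.isUnit_iff_isUnit_det M).2 (isUnit_iff_ne_zero.2 hM)
  refine ⟨(LinearEquiv.ofBijective M.mulVecLin ⟨Matrix.mulVec_injective_iff_isUnit.2 hu,
    Matrix.mulVec_surjective_iff_isUnit.2 hu⟩).toContinuousLinearEquiv, ?_⟩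
  ext v
  rfl

/-- The inverse function theorem for globally smooth maps. -/
theorem exists_localDiffeo {X Y : Type*} [NormedAddCommGroup X] [NormedSpace ℝ X] [CompleteSpace X]
    [NormedAddCommGroup Y] [NormedSpace ℝ Y] {f : X → Y} (hf : ContDiff ℝ ∞ f) (x : X)
    (e : X ≃L[ℝ] Y) (he : HasFDerivAt f (e : X →L[ℝ] Y) x) :
    ∃ φ : OpenPartialHomeomorph X Y, ⇑φ = f ∧ x ∈ φ.source ∧
      ContDiffOn ℝ ∞ φ.symm φ.target := by
  have hn : (∞ : WithTop ℕ∞) ≠ 0 := by simp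
  let φ₀ := hf.contDiffAt.toOpenPartialHomeomorph f he hn
  let O : Set X := {y | fderiv ℝ f y ∈ Set.range ((↑) : (X ≃L[ℝ] Y) → (X →L[ℝ] Y))}
  have hO : IsOpen O := ContinuousLinearEquiv.isOpen.preimage (hf.continuous_fderiv hn)
  refine ⟨φ₀.restrOpen O hO, rfl,
    ⟨hf.contDiffAt.mem_toOpenPartialHomeomorph_source he hn, e, he.fderiv.symm⟩, ?_⟩
  intro y hy
  refine ContDiffAt.contDiffWithinAt ?_
  obtain ⟨e', he'⟩ := ((φ₀.restrOpen O hO).map_target hy).2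
  refine OpenPartialHomeomorph.contDiffAt_symm _ hy (f₀' := e') ?_ hf.contDiffAt
  rw [he']
  exact (hf.differentiable hn _).hasFDerivAt

section Lagrange

variable {n k : ℕ} (h : Fin k → MvPolynomial (Fin n) ℝ)

/-- The point with `x`-component `x` and multiplier component `lam`. -/
def pairPoint (x : EuclideanSpace ℝ (Fin n)) (lam : Fin k → ℝ) : Fin n ⊕ Fin k → ℝ :=
  Sum.elim (fun i => x i) lam

/-- The `x`-component of a point. -/
def xPart (z : Fin n ⊕ Fin k → ℝ) : EuclideanSpace ℝ (Fin n) :=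
  WithLp.toLp 2 fun i => z (Sum.inl i)

@[simp] theorem xPart_pairPoint (x : EuclideanSpace ℝ (Fin n)) (lam : Fin k → ℝ) :
    xPart (pairPoint x lam) = x := rfl

/-- `xPart` as a continuous linear map. -/
noncomputable def xPartL : (Fin n ⊕ Fin k → ℝ) →L[ℝ] EuclideanSpace ℝ (Fin n) :=
  LinearMap.toContinuousLinearMap
    { toFun := xPart
      map_add' := fun _ _ => rfl
      map_smul' := fun _ _ => rfl }

theorem pairPoint_xPart (z : Fin n ⊕ Fin k → ℝ) :
    pairPoint (xPart z) (fun j => z (Sum.inr j)) = z := by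
  ext (i | j) <;> rfl

theorem contDiff_xPart {m : WithTop ℕ∞} :
    ContDiff ℝ m (xPart : (Fin n ⊕ Fin k → ℝ) → EuclideanSpace ℝ (Fin n)) := by
  exact xPartL.contDiff

theorem contDiff_pairPoint_zero {m : WithTop ℕ∞} :
    ContDiff ℝ m (fun b : EuclideanSpace ℝ (Fin n) => pairPoint b (0 : Fin k → ℝ)) := by
  rw [contDiff_pi]
  rintro (i | j)
  · change ContDiff ℝ m (fun b : EuclideanSpace ℝ (Fin n) => b i)
    fun_prop
  · exact contDiff_const

theorem continuous_pairPoint :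
    Continuous (fun p : EuclideanSpace ℝ (Fin n) × (Fin k → ℝ) => pairPoint p.1 p.2) := by
  refine continuous_pi ?_
  rintro (i | j)
  · change Continuous (fun p : EuclideanSpace ℝ (Fin n) × (Fin k → ℝ) => p.1 i)
    fun_prop
  · change Continuous (fun p : EuclideanSpace ℝ (Fin n) × (Fin k → ℝ) => p.2 j)
    fun_prop

/-- The Jacobian matrix of the constraints at a point of `ℝⁿ`. -/
noncomputable abbrev jac (x : EuclideanSpace ℝ (Fin n)) : Matrix (Fin k) (Fin n) ℝ :=
  jacobian h (fun i => x i)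

theorem continuous_jac : Continuous (jac h) := by
  refine continuous_pi fun j => continuous_pi fun i => ?_
  have h1 := (contDiff_polyMap fun _ : Unit => MvPolynomial.pderiv i (h j)).continuous
  exact (continuous_apply ()).comp
    (h1.comp (by fun_prop : Continuous fun x : EuclideanSpace ℝ (Fin n) => fun i => x i))

/-- The map `(x, lam) ↦ (x - J(x)ᵗ lam, h x)`. -/
noncomputable def lagrangeMap (z : Fin n ⊕ Fin k → ℝ) : Fin n ⊕ Fin k → ℝ :=
  fun s => MvPolynomial.aeval z (lagrangeSystem h 0 s)

theorem lagrangeMap_pairPoint (x : EuclideanSpace ℝ (Fin n)) (lam : Fin k → ℝ) :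
    lagrangeMap h (pairPoint x lam) =
      Sum.elim (fun i => x i - (Matrix.vecMul lam (jac h x)) i)
        (fun j => MvPolynomial.eval (fun i => x i) (h j)) := by
  ext (i | j)
  · simp [lagrangeMap, lagrangeSystem, MvPolynomial.eval_rename, jacobian, Matrix.vecMul,
      dotProduct, pairPoint, Function.comp_def]
  · simp [lagrangeMap, lagrangeSystem, MvPolynomial.eval_rename, MvPolynomial.aeval_eq_eval,
      pairPoint, Function.comp_def]

/-- The real Lagrange zeros for `b` are the points of the fibre of `lagrangeMap` over `(b, 0)`. -/
theorem lagrangeMap_eq_iff {x b : EuclideanSpace ℝ (Fin n)} {lam : Fin k → ℝ} :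
    lagrangeMap h (pairPoint x lam) = pairPoint b 0 ↔
      x ∈ realZeroSet h ∧ ∀ i, b i - x i = - (Matrix.vecMul lam (jac h x)) i := by
  rw [lagrangeMap_pairPoint, pairPoint, funext_iff, Sum.forall]
  simp only [Sum.elim_inl, Sum.elim_inr, realZeroSet, Set.mem_ofPred_eq, Pi.zero_apply]
  rw [and_comm]
  refine and_congr Iff.rfl (forall_congr' fun i => ?_)
  constructor <;> intro H <;> linarith

theorem jacobian_lagrangeSystem_eq {A : Type*} [CommRing A] [Algebra ℝ A]
    (b : EuclideanSpace ℝ (Fin n)) (z : Fin n ⊕ Fin k → A) :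
    jacobian (lagrangeSystem h b) z = jacobian (lagrangeSystem h 0) z := by
  ext (i | j) s <;> simp [jacobian, lagrangeSystem]

theorem pderiv_rename_inl_inr (p : MvPolynomial (Fin n) ℝ) (j : Fin k) :
    MvPolynomial.pderiv (Sum.inr j) (MvPolynomial.rename (Sum.inl : _ → Fin n ⊕ Fin k) p) = 0 := by
  refine MvPolynomial.pderiv_eq_zero_of_notMem_vars fun hmem => ?_
  classical
  have := MvPolynomial.vars_rename Sum.inl p hmem
  simp at this

theorem jacobian_lagrangeSystem_zero (x : EuclideanSpace ℝ (Fin n)) :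
    jacobian (lagrangeSystem h 0) (pairPoint x 0) =
      Matrix.fromBlocks 1 (-(jac h x).transpose) (jac h x) 0 := by
  classical
  ext (i | j) (i' | j')
  · simp [jacobian, lagrangeSystem, pairPoint, MvPolynomial.pderiv_X, Pi.single_apply,
      Matrix.one_apply, apply_ite]
  · simp [jacobian, lagrangeSystem, pairPoint, MvPolynomial.pderiv_X, Pi.single_apply,
      pderiv_rename_inl_inr, MvPolynomial.eval_rename, Function.comp_def, apply_ite]
  · simp [jacobian, lagrangeSystem, pairPoint,
      MvPolynomial.pderiv_rename Sum.inl_injective, MvPolynomial.eval_rename, Function.comp_def]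
  · simp [jacobian, lagrangeSystem, pderiv_rename_inl_inr]

variable {h}

theorem det_gram_ne_zero {x : EuclideanSpace ℝ (Fin n)} (hx : (jac h x).rank = k) :
    (jac h x * (jac h x).transpose).det ≠ 0 := by
  have h1 := Matrix.rank_self_mul_transpose (jac h x)
  rw [hx] at h1
  have h2 : LinearIndependent ℝ (jac h x * (jac h x).transpose).row := by
    rw [linearIndependent_iff_card_eq_finrank_span, Set.finrank, ← Matrix.rank_eq_finrank_span_row, h1,
      Fintype.card_fin]
  exact ((Matrix.isUnit_iff_isUnit_det _).1 (Matrix.linearIndependent_rows_iff_isUnit.1 h2)).ne_zero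

theorem det_jacobian_lagrangeSystem_zero {x : EuclideanSpace ℝ (Fin n)}
    (hx : (jac h x).rank = k) :
    (jacobian (lagrangeSystem h 0) (pairPoint x 0)).det ≠ 0 := by
  rw [jacobian_lagrangeSystem_zero, Matrix.det_fromBlocks_one₁₁]
  simpa using det_gram_ne_zero hx

/-- Where the Lagrange system has nonsingular Jacobian, it is locally a diffeomorphism. -/
theorem exists_lagrange_localDiffeo {z : Fin n ⊕ Fin k → ℝ}
    (hz : (jacobian (lagrangeSystem h 0) z).det ≠ 0) :
    ∃ φ : OpenPartialHomeomorph (Fin n ⊕ Fin k → ℝ) (Fin n ⊕ Fin k → ℝ),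
      ⇑φ = lagrangeMap h ∧ z ∈ φ.source ∧ ContDiffOn ℝ ∞ φ.symm φ.target := by
  obtain ⟨e, he⟩ := exists_equiv_of_det_ne_zero hz
  refine exists_localDiffeo (contDiff_polyMap (lagrangeSystem h 0)) z e ?_
  rw [he]
  exact (hasStrictFDerivAt_polyMap _ z).hasFDerivAt

/-- The constraint map has derivative given by its Jacobian matrix. -/
theorem hasFDerivAt_constraints (x : EuclideanSpace ℝ (Fin n)) :
    HasFDerivAt (fun (y : EuclideanSpace ℝ (Fin n)) (j : Fin k) =>
        MvPolynomial.eval (fun i => y i) (h j))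
      ((LinearMap.toContinuousLinearMap (jac h x).mulVecLin).comp
        (EuclideanSpace.equiv (Fin n) ℝ : EuclideanSpace ℝ (Fin n) →L[ℝ] (Fin n → ℝ))) x := by
  have := (hasStrictFDerivAt_polyMap h (fun i => x i)).hasFDerivAt.comp x
    (EuclideanSpace.equiv (Fin n) ℝ).hasFDerivAt
  simp only [MvPolynomial.aeval_eq_eval] at this
  exact this

theorem mulVec_eq_zero_of_mem_tangentVectors {x w : EuclideanSpace ℝ (Fin n)}
    (hw : w ∈ tangentVectors (realZeroSet h) x) : (jac h x).mulVec (fun i => w i) = 0 := by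
  obtain ⟨ε, γ, hε, -, hV, rfl, hd⟩ := hw
  have h1 := (hasFDerivAt_constraints (h := h) (γ 0)).comp_hasDerivAt 0 hd
  have h2 : HasDerivAt ((fun (y : EuclideanSpace ℝ (Fin n)) (j : Fin k) =>
        MvPolynomial.eval (fun i => y i) (h j)) ∘ γ) 0 0 := by
    refine (hasDerivAt_const (0 : ℝ) (0 : Fin k → ℝ)).congr_of_eventuallyEq ?_
    filter_upwards [Ioo_mem_nhds (neg_lt_zero.2 hε) hε] with t ht
    ext j
    exact hV t ht j
  exact h1.unique h2

theorem mem_tangentVectors_of_mulVec_eq_zero {x w : EuclideanSpace ℝ (Fin n)}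
    (hxV : x ∈ realZeroSet h) (hx : (jac h x).rank = k)
    (hw : (jac h x).mulVec (fun i => w i) = 0) : w ∈ tangentVectors (realZeroSet h) x := by
  have hdet := det_jacobian_lagrangeSystem_zero hx
  obtain ⟨φ, hφ, hz, hsm⟩ := exists_lagrange_localDiffeo hdet
  obtain ⟨e, he⟩ := exists_equiv_of_det_ne_zero hdet
  have hφx : φ (pairPoint x 0) = pairPoint x 0 := by
    rw [hφ, lagrangeMap_eq_iff]
    exact ⟨hxV, by simp⟩
  have hxt : pairPoint x 0 ∈ φ.target := hφx ▸ φ.map_source hz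
  have hsx : φ.symm (pairPoint x 0) = pairPoint x 0 := by
    conv_lhs => rw [← hφx]
    exact φ.left_inv hz
  let c : ℝ → Fin n ⊕ Fin k → ℝ := fun t => pairPoint (x + t • w) 0
  have hc : ContDiff ℝ ∞ c := contDiff_pairPoint_zero.comp (by fun_prop)
  have hc0 : c 0 = pairPoint x 0 := by simp [c]
  have hopen : c ⁻¹' φ.target ∈ nhds 0 :=
    (φ.open_target.preimage hc.continuous).mem_nhds (by simpa [hc0] using hxt)
  obtain ⟨ε, hε, hball⟩ := Metric.mem_nhds_iff.1 hopen
  rw [Real.ball_eq_Ioo, zero_sub, zero_add] at hball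
  refine ⟨ε, fun t => xPart (φ.symm (c t)), hε, ?_, ?_, ?_, ?_⟩
  · exact contDiff_xPart.comp_contDiffOn (hsm.comp hc.contDiffOn hball)
  · intro t ht
    have : lagrangeMap h (φ.symm (c t)) = pairPoint (x + t • w) 0 := by
      rw [← hφ, φ.right_inv (hball ht)]
    rw [← pairPoint_xPart (φ.symm (c t)), lagrangeMap_eq_iff] at this
    exact this.1
  · simp [hc0, hsx]
  · have hcd : HasDerivAt c (pairPoint w 0) 0 := by
      rw [hasDerivAt_pi]
      rintro (i | j)
      · have : HasDerivAt (fun t : ℝ => x i + t * w i) (1 * w i) 0 :=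
          ((hasDerivAt_id (0 : ℝ)).mul_const (w i)).const_add (x i)
        simpa [c, pairPoint] using this
      · exact hasDerivAt_const _ _
    have hinv : HasFDerivAt φ.symm (e.symm : (Fin n ⊕ Fin k → ℝ) →L[ℝ] (Fin n ⊕ Fin k → ℝ))
        (c 0) := by
      refine φ.hasFDerivAt_symm (hc0 ▸ hxt) ?_
      rw [hc0, hsx, he, hφ]
      exact (hasStrictFDerivAt_polyMap _ _).hasFDerivAt
    have hew : e (pairPoint w 0) = pairPoint w 0 := by
      have : e (pairPoint w 0) = (jacobian (lagrangeSystem h 0) (pairPoint x 0)).mulVec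
          (pairPoint w 0) := congrArg (fun f => f (pairPoint w 0)) he
      rw [this, jacobian_lagrangeSystem_zero, pairPoint, Matrix.fromBlocks_mulVec]
      have h0 : (fun _ : Fin k => (0 : ℝ)) = 0 := rfl
      simp [Function.comp_def, hw, h0]
    have h1 := hinv.comp_hasDerivAt 0 hcd
    have hes : e.symm (pairPoint w 0) = pairPoint w (0 : Fin k → ℝ) := by
      rw [ContinuousLinearEquiv.symm_apply_eq, hew]
    have hX : HasFDerivAt (xPart : (Fin n ⊕ Fin k → ℝ) → EuclideanSpace ℝ (Fin n))
        (xPartL : (Fin n ⊕ Fin k → ℝ) →L[ℝ] EuclideanSpace ℝ (Fin n)) (φ.symm (c 0)) :=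
      xPartL.hasFDerivAt
    have h2 := hX.comp_hasDerivAt 0 h1
    rw [ContinuousLinearEquiv.coe_coe, hes] at h2
    exact h2

variable (h) in
/-- The multiplier of a normal vector `v` at `x`. -/
noncomputable def multiplier (x v : EuclideanSpace ℝ (Fin n)) : Fin k → ℝ :=
  -((jac h x * (jac h x).transpose)⁻¹.mulVec ((jac h x).mulVec fun i => v i))

theorem inner_eq_dotProduct (v w : EuclideanSpace ℝ (Fin n)) :
    inner ℝ v w = (fun i => v i) ⬝ᵥ fun i => w i := by
  simp [PiLp.inner_apply, dotProduct, mul_comm]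

theorem lagrangeMap_multiplier {x v : EuclideanSpace ℝ (Fin n)} (hx : (jac h x).rank = k)
    (hv : (x, v) ∈ normalBundle (realZeroSet h)) :
    lagrangeMap h (pairPoint x (multiplier h x v)) = pairPoint (x + v) 0 := by
  set m := multiplier h x v with hm
  let u : EuclideanSpace ℝ (Fin n) := WithLp.toLp 2 fun i => v i + Matrix.vecMul m (jac h x) i
  have hu' : (fun i => u i) = (fun i => v i) + Matrix.vecMul m (jac h x) := rfl
  have hJu : (jac h x).mulVec (fun i => u i) = 0 := by
    rw [hu', Matrix.mulVec_add, ← Matrix.mulVec_transpose, Matrix.mulVec_mulVec, hm, multiplier,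
      Matrix.mulVec_neg, Matrix.mulVec_mulVec, Matrix.mul_nonsing_inv _
        (isUnit_iff_ne_zero.2 (det_gram_ne_zero hx)), Matrix.one_mulVec, add_neg_cancel]
  have h1 := hv.2 u (mem_tangentVectors_of_mulVec_eq_zero hv.1 hx hJu)
  have h2 : u = 0 := by
    rw [← inner_self_eq_zero (𝕜 := ℝ), inner_eq_dotProduct]
    nth_rewrite 1 [hu']
    rw [add_dotProduct, ← Matrix.dotProduct_mulVec, hJu, dotProduct_zero, add_zero,
      ← inner_eq_dotProduct]
    exact h1
  rw [lagrangeMap_eq_iff]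
  refine ⟨hv.1, fun i => ?_⟩
  have h3 : v i + Matrix.vecMul m (jac h x) i = 0 := congrArg (fun y => y i) h2
  simp only [PiLp.add_apply]
  linarith

theorem mem_normalBundle_of_lagrangeMap_eq {x b : EuclideanSpace ℝ (Fin n)} {lam : Fin k → ℝ}
    (hL : lagrangeMap h (pairPoint x lam) = pairPoint b 0) :
    (x, b - x) ∈ normalBundle (realZeroSet h) := by
  rw [lagrangeMap_eq_iff] at hL
  refine ⟨hL.1, fun w hw => ?_⟩
  have hJ := mulVec_eq_zero_of_mem_tangentVectors hw
  have hv : (fun i => (b - x) i) = -Matrix.vecMul lam (jac h x) := by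
    ext i
    exact hL.2 i
  rw [inner_eq_dotProduct, hv, neg_dotProduct, ← Matrix.dotProduct_mulVec, hJ, dotProduct_zero,
    neg_zero]

theorem continuousAt_multiplier {x₀ : EuclideanSpace ℝ (Fin n)} (hx : (jac h x₀).rank = k) :
    ContinuousAt (fun p : EuclideanSpace ℝ (Fin n) × EuclideanSpace ℝ (Fin n) =>
      multiplier h p.1 p.2) (x₀, 0) := by
  have hJ : Continuous fun p : EuclideanSpace ℝ (Fin n) × EuclideanSpace ℝ (Fin n) => jac h p.1 :=
    (continuous_jac h).comp continuous_fst
  have hG : Continuous fun p : EuclideanSpace ℝ (Fin n) × EuclideanSpace ℝ (Fin n) =>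
      jac h p.1 * (jac h p.1).transpose := hJ.matrix_mul hJ.matrix_transpose
  have hd := det_gram_ne_zero hx
  have hJv : Continuous fun p : EuclideanSpace ℝ (Fin n) × EuclideanSpace ℝ (Fin n) =>
      (jac h p.1).mulVec fun i => p.2 i := hJ.matrix_mulVec (by fun_prop)
  have hinv : ContinuousAt (fun p : EuclideanSpace ℝ (Fin n) × EuclideanSpace ℝ (Fin n) =>
      (jac h p.1 * (jac h p.1).transpose)⁻¹) (x₀, 0) := by
    refine ContinuousAt.comp (f := fun p : EuclideanSpace ℝ (Fin n) × EuclideanSpace ℝ (Fin n) =>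
      jac h p.1 * (jac h p.1).transpose) (g := fun M => M⁻¹) (continuousAt_matrix_inv _ ?_)
      hG.continuousAt
    have : (Ring.inverse : ℝ → ℝ) = fun a => a⁻¹ := funext Ring.inverse_eq_inv
    rw [this]
    exact continuousAt_inv₀ hd
  exact ((Continuous.matrix_mulVec continuous_fst continuous_snd).continuousAt.comp
    (hinv.prodMk hJv.continuousAt)).neg

theorem isClosed_realZeroSet : IsClosed (realZeroSet h) := by
  have : realZeroSet h = (fun (y : EuclideanSpace ℝ (Fin n)) (j : Fin k) =>
      MvPolynomial.eval (fun i => y i) (h j)) ⁻¹' {0} := by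
    ext y
    exact ⟨fun hy => funext hy, fun hy j => congrFun hy j⟩
  rw [this]
  exact isClosed_singleton.preimage
    (continuous_iff_continuousAt.2 fun x => (hasFDerivAt_constraints x).continuousAt)

theorem exists_isNearestPoint (hne : (realZeroSet h).Nonempty) (b : EuclideanSpace ℝ (Fin n)) :
    ∃ x, IsNearestPoint (realZeroSet h) b x := by
  obtain ⟨y, hy, hd⟩ := isClosed_realZeroSet.exists_infDist_eq_dist hne b
  exact ⟨y, hy, fun z hz => hd ▸ Metric.infDist_le_dist_of_mem hz⟩

theorem IsNearestPoint.mem_normalBundle {M : Set (EuclideanSpace ℝ (Fin n))}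
    {b x : EuclideanSpace ℝ (Fin n)} (hx : IsNearestPoint M b x) : (x, b - x) ∈ normalBundle M := by
  refine ⟨hx.1, ?_⟩
  rintro w ⟨ε, γ, hε, -, hM, h0, hd⟩
  have h1 : HasDerivAt (fun t => ‖b - γ t‖ ^ 2) (2 * inner ℝ (b - γ 0) (-w)) 0 := by
    simpa using (hd.const_sub b).norm_sq
  have hmin : IsLocalMin (fun t => ‖b - γ t‖ ^ 2) 0 := by
    filter_upwards [Ioo_mem_nhds (neg_lt_zero.2 hε) hε] with t ht
    have := hx.2 (γ t) (hM t ht)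
    simp only [dist_eq_norm] at this
    rw [h0]
    gcongr
  have h2 := hmin.hasDerivAt_eq_zero h1
  rw [h0, inner_neg_right] at h2
  change inner ℝ (b - x) w = 0
  linarith

end Lagrange

variable {n k : ℕ} {h : Fin k → MvPolynomial (Fin n) ℝ}

/-- A real polynomial system with Jacobian of full rank along its zero set defines an embedded
submanifold. -/
theorem isEmbeddedSubmanifold_realZeroSet
    (hrank : ∀ x ∈ realZeroSet h, (jac h x).rank = k) :
    IsEmbeddedSubmanifold (n - k) (realZeroSet h) := by
  intro x hx
  have hdet := det_gram_ne_zero (hrank x hx)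
  let H : EuclideanSpace ℝ (Fin n) → Fin k → ℝ :=
    fun y j => MvPolynomial.eval (fun i => y i) (h j)
  have hHs : ContDiff ℝ ∞ H := by
    have := (contDiff_polyMap h).comp (EuclideanSpace.equiv (Fin n) ℝ).contDiff
    simp only [MvPolynomial.aeval_eq_eval] at this
    exact this
  let D : EuclideanSpace ℝ (Fin n) →L[ℝ] (Fin k → ℝ) :=
    (LinearMap.toContinuousLinearMap (jac h x).mulVecLin).comp
      (EuclideanSpace.equiv (Fin n) ℝ : EuclideanSpace ℝ (Fin n) →L[ℝ] (Fin n → ℝ))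
  have hD : HasFDerivAt H D x := hasFDerivAt_constraints x
  let T : (Fin k → ℝ) →L[ℝ] EuclideanSpace ℝ (Fin n) :=
    ((EuclideanSpace.equiv (Fin n) ℝ).symm : (Fin n → ℝ) →L[ℝ] EuclideanSpace ℝ (Fin n)).comp
      (LinearMap.toContinuousLinearMap
        ((jac h x).transpose * (jac h x * (jac h x).transpose)⁻¹).mulVecLin)
  have hDT : ∀ c, D (T c) = c := by
    intro c
    change (jac h x).mulVec
      (((jac h x).transpose * (jac h x * (jac h x).transpose)⁻¹).mulVec c) = c
    rw [Matrix.mulVec_mulVec, ← Matrix.mul_assoc,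
      Matrix.mul_nonsing_inv _ (isUnit_iff_ne_zero.2 hdet), Matrix.one_mulVec]
  let f : EuclideanSpace ℝ (Fin n) → EuclideanSpace ℝ (Fin n) := fun y => y - T (D y) + T (H y)
  have hf : ContDiff ℝ ∞ f :=
    (contDiff_id.sub (T.contDiff.comp D.contDiff)).add (T.contDiff.comp hHs)
  have hfd : HasFDerivAt f ((ContinuousLinearEquiv.refl ℝ (EuclideanSpace ℝ (Fin n)) :
      EuclideanSpace ℝ (Fin n) →L[ℝ] EuclideanSpace ℝ (Fin n))) x := by
    have := ((hasFDerivAt_id x).sub (T.hasFDerivAt.comp x D.hasFDerivAt)).add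
      (T.hasFDerivAt.comp x hD)
    refine this.congr_fderiv ?_
    ext v
    simp
  obtain ⟨φ, hφ, hxφ, hsm⟩ := exists_localDiffeo hf x _ hfd
  refine ⟨φ, hxφ, hφ ▸ hf.contDiffOn, hsm, LinearMap.ker D.toLinearMap, ?_, ?_⟩
  · have h1 := LinearMap.finrank_range_add_finrank_ker D.toLinearMap
    have h2 : LinearMap.range D.toLinearMap = ⊤ :=
      LinearMap.range_eq_top.2 fun c => ⟨T c, hDT c⟩
    rw [h2, finrank_top] at h1
    simp only [Module.finrank_fin_fun, finrank_euclideanSpace_fin] at h1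
    omega
  · intro y _
    have : D (φ y) = H y := by simp [hφ, f, hDT]
    rw [LinearMap.mem_ker]
    change _ ↔ D (φ y) = 0
    rw [this]
    exact ⟨fun hy => funext hy, fun hy j => congrFun hy j⟩

variable (h) in
/-- The normal vector `v` at `x` is regular if `x` is the only nearest point to `x + v` and
the Lagrange system at `(x, multiplier h x v)` has nonsingular Jacobian. -/
def IsRegularNormal (x v : EuclideanSpace ℝ (Fin n)) : Prop :=
  (∀ y, IsNearestPoint (realZeroSet h) (x + v) y → y = x) ∧
    (jacobian (lagrangeSystem h 0) (pairPoint x (multiplier h x v))).det ≠ 0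

variable (h) in
/-- All normal vectors of length less than `r` at points at distance less than `r` from `x₀` are
regular. -/
def IsRegularRadius (x₀ : EuclideanSpace ℝ (Fin n)) (r : ℝ) : Prop :=
  ∀ x v, (x, v) ∈ normalBundle (realZeroSet h) → dist x x₀ < r → ‖v‖ < r → IsRegularNormal h x v

theorem continuous_jacobian_lagrangeSystem :
    Continuous fun z : Fin n ⊕ Fin k → ℝ => jacobian (lagrangeSystem h 0) z := by
  refine continuous_pi fun s => continuous_pi fun t => ?_
  have h1 := (contDiff_polyMap
    fun _ : Unit => MvPolynomial.pderiv t (lagrangeSystem h 0 s)).continuous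
  exact (continuous_apply ()).comp h1

theorem exists_isRegularRadius (hrank : ∀ x ∈ realZeroSet h, (jac h x).rank = k)
    {x₀ : EuclideanSpace ℝ (Fin n)} (hx₀ : x₀ ∈ realZeroSet h) :
    ∃ r, 0 < r ∧ r ≤ 1 ∧ IsRegularRadius h x₀ r := by
  have hdet := det_jacobian_lagrangeSystem_zero (hrank x₀ hx₀)
  obtain ⟨φ, hφ, hz, -⟩ := exists_lagrange_localDiffeo hdet
  let m : EuclideanSpace ℝ (Fin n) × EuclideanSpace ℝ (Fin n) → Fin n ⊕ Fin k → ℝ :=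
    fun p => pairPoint p.1 (multiplier h p.1 p.2)
  have hm : ContinuousAt m (x₀, 0) :=
    continuous_pairPoint.continuousAt.comp
      (continuousAt_fst.prodMk (continuousAt_multiplier (hrank x₀ hx₀)))
  have hm0 : m (x₀, 0) = pairPoint x₀ 0 := by
    have h0 : (fun _ : Fin n => (0 : ℝ)) = 0 := rfl
    simp [m, multiplier, h0]
  have h1 : ∀ᶠ p in nhds (x₀, (0 : EuclideanSpace ℝ (Fin n))), m p ∈ φ.source ∧
      (jacobian (lagrangeSystem h 0) (m p)).det ≠ 0 := by
    refine (hm.eventually (φ.open_source.mem_nhds (by rwa [hm0]))).and ?_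
    have hc : Continuous fun z : Fin n ⊕ Fin k → ℝ => (jacobian (lagrangeSystem h 0) z).det :=
      continuous_jacobian_lagrangeSystem.matrix_det
    exact hm.eventually (hc.continuousAt.eventually_ne (by rwa [hm0]))
  obtain ⟨ε, hε, hball⟩ := Metric.eventually_nhds_iff.1 h1
  refine ⟨min 1 (ε / 3), by positivity, min_le_left _ _, ?_⟩
  intro x v hxv hx hv
  have hx' := hx.trans_le (min_le_right _ _)
  have hv' := hv.trans_le (min_le_right _ _)
  have key : ∀ y w, dist y x₀ < ε → ‖w‖ < ε → m (y, w) ∈ φ.source ∧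
      (jacobian (lagrangeSystem h 0) (m (y, w))).det ≠ 0 := by
    intro y w hy hw
    refine hball ?_
    rw [Prod.dist_eq, dist_zero_right]
    exact max_lt hy hw
  have hxm := key x v (by linarith) (by linarith)
  refine ⟨fun y hy => ?_, hxm.2⟩
  have hyn := hy.mem_normalBundle
  have hdy : dist (x + v) y ≤ ‖v‖ := by simpa using hy.2 x hxv.1
  have hw : ‖x + v - y‖ < ε := by
    rw [← dist_eq_norm]; linarith
  have hyx : dist y x₀ < ε := by
    have h2 := dist_triangle4 y (x + v) x x₀
    rw [dist_comm y (x + v), dist_self_add_left] at h2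
    linarith
  have hym := key y _ hyx hw
  have hLx := lagrangeMap_multiplier (hrank x hxv.1) hxv
  have hLy := lagrangeMap_multiplier (hrank y hy.1) hyn
  rw [add_sub_cancel] at hLy
  have := φ.injOn hym.1 hxm.1 (by rw [hφ]; exact hLy.trans hLx.symm)
  exact congrArg xPart this

variable (h) in
/-- The radius function of the tubular neighborhood. -/
noncomputable def tubeRadius (x : EuclideanSpace ℝ (Fin n)) : ℝ :=
  sSup {r | 0 < r ∧ r ≤ 1 ∧ IsRegularRadius h x r}

theorem bddAbove_regularRadii (x : EuclideanSpace ℝ (Fin n)) :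
    BddAbove {r | 0 < r ∧ r ≤ 1 ∧ IsRegularRadius h x r} :=
  ⟨1, fun _ hr => hr.2.1⟩

theorem tubeRadius_pos (hrank : ∀ x ∈ realZeroSet h, (jac h x).rank = k)
    {x : EuclideanSpace ℝ (Fin n)} (hx : x ∈ realZeroSet h) : 0 < tubeRadius h x := by
  obtain ⟨r, hr⟩ := exists_isRegularRadius hrank hx
  exact hr.1.trans_le (le_csSup (bddAbove_regularRadii x) hr)

theorem tubeRadius_nonneg (x : EuclideanSpace ℝ (Fin n)) : 0 ≤ tubeRadius h x :=
  Real.sSup_nonneg fun _ hr => hr.1.le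

theorem tubeRadius_le_add (x y : EuclideanSpace ℝ (Fin n)) :
    tubeRadius h x ≤ tubeRadius h y + dist x y := by
  refine Real.sSup_le (fun r hr => ?_) (add_nonneg (tubeRadius_nonneg y) dist_nonneg)
  rcases le_or_gt r (dist x y) with hle | hlt
  · linarith [tubeRadius_nonneg (h := h) y]
  · have : r - dist x y ≤ tubeRadius h y := by
      refine le_csSup (bddAbove_regularRadii y) ⟨by linarith, by
        linarith [hr.2.1, dist_nonneg (x := x) (y := y)], fun u v huv hu hv => ?_⟩
      refine hr.2.2 u v huv ?_ ?_
      · have := dist_triangle u y x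
        rw [dist_comm y x] at this
        linarith
      · linarith [dist_nonneg (x := x) (y := y)]
    linarith

theorem continuous_tubeRadius : Continuous (tubeRadius h) := by
  refine (LipschitzWith.of_le_add fun x y => tubeRadius_le_add x y).continuous

theorem isRegularNormal_of_lt_tubeRadius {x v : EuclideanSpace ℝ (Fin n)}
    (hxv : (x, v) ∈ normalBundle (realZeroSet h)) (hv : ‖v‖ < tubeRadius h x) :
    IsRegularNormal h x v := by
  have hne : {r | 0 < r ∧ r ≤ 1 ∧ IsRegularRadius h x r}.Nonempty := by
    by_contra hemp
    rw [Set.not_nonempty_iff_eq_empty] at hemp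
    rw [tubeRadius, hemp, Real.sSup_empty] at hv
    exact absurd hv (not_lt.2 (norm_nonneg v))
  obtain ⟨r, hr, hvr⟩ := exists_lt_of_lt_csSup hne hv
  exact hr.2.2 x v hxv (by simpa using hr.1) hvr

variable (h) in
/-- The normal vectors shorter than the tube radius. -/
def tubeBundle : Set (EuclideanSpace ℝ (Fin n) × EuclideanSpace ℝ (Fin n)) :=
  {p | p ∈ normalBundle (realZeroSet h) ∧ ‖p.2‖ < tubeRadius h p.1}

theorem eq_of_mem_tubeBundle (hne : (realZeroSet h).Nonempty)
    {p q : EuclideanSpace ℝ (Fin n) × EuclideanSpace ℝ (Fin n)}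
    (hp : p ∈ tubeBundle h) (hq : q ∈ tubeBundle h) (hpq : p.1 + p.2 = q.1 + q.2) : p = q := by
  obtain ⟨y, hy⟩ := exists_isNearestPoint hne (p.1 + p.2)
  have h1 := (isRegularNormal_of_lt_tubeRadius hp.1 hp.2).1 y hy
  have h2 := (isRegularNormal_of_lt_tubeRadius hq.1 hq.2).1 y (hpq ▸ hy)
  have h3 : p.1 = q.1 := h1.symm.trans h2
  exact Prod.ext h3 (by rwa [h3, add_right_inj] at hpq)

/-- Near the foot of a tube vector, the addition map has a smooth local section. -/
theorem exists_local_section (hrank : ∀ x ∈ realZeroSet h, (jac h x).rank = k)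
    {p : EuclideanSpace ℝ (Fin n) × EuclideanSpace ℝ (Fin n)} (hp : p ∈ tubeBundle h) :
    ∃ O : Set (EuclideanSpace ℝ (Fin n)), IsOpen O ∧ p.1 + p.2 ∈ O ∧
      ∃ g : EuclideanSpace ℝ (Fin n) → EuclideanSpace ℝ (Fin n) × EuclideanSpace ℝ (Fin n),
        ContDiffOn ℝ ∞ g O ∧ ∀ b ∈ O, g b ∈ tubeBundle h ∧ (g b).1 + (g b).2 = b := by
  obtain ⟨x, v⟩ := p
  have hxV : x ∈ realZeroSet h := hp.1.1
  have hreg := isRegularNormal_of_lt_tubeRadius hp.1 hp.2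
  obtain ⟨φ, hφ, hz, hsm⟩ := exists_lagrange_localDiffeo hreg.2
  have hφx : φ (pairPoint x (multiplier h x v)) = pairPoint (x + v) 0 := by
    rw [hφ]
    exact lagrangeMap_multiplier (hrank x hxV) hp.1
  let ι : EuclideanSpace ℝ (Fin n) → Fin n ⊕ Fin k → ℝ := fun b => pairPoint b 0
  have hι : ContDiff ℝ ∞ ι := contDiff_pairPoint_zero
  let O₁ := ι ⁻¹' φ.target
  have hO₁ : IsOpen O₁ := φ.open_target.preimage hι.continuous
  have hb₁ : x + v ∈ O₁ := by
    change pairPoint (x + v) 0 ∈ φ.target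
    exact hφx ▸ φ.map_source hz
  let π : EuclideanSpace ℝ (Fin n) → EuclideanSpace ℝ (Fin n) := fun b => xPart (φ.symm (ι b))
  have hπ : ContDiffOn ℝ ∞ π O₁ :=
    contDiff_xPart.comp_contDiffOn (hsm.comp hι.contDiffOn fun _ hb => hb)
  have hπx : π (x + v) = x := by
    have : φ.symm (ι (x + v)) = pairPoint x (multiplier h x v) := by
      change φ.symm (pairPoint (x + v) 0) = _
      rw [← hφx, φ.left_inv hz]
    simp [π, this]
  have hcont : ContinuousOn (fun b => tubeRadius h (π b) - ‖b - π b‖) O₁ :=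
    (continuous_tubeRadius.comp_continuousOn hπ.continuousOn).sub
      (continuousOn_id.sub hπ.continuousOn).norm
  refine ⟨O₁ ∩ (fun b => tubeRadius h (π b) - ‖b - π b‖) ⁻¹' Set.Ioi 0,
    hcont.isOpen_inter_preimage hO₁ isOpen_Ioi, ⟨hb₁, ?_⟩, fun b => (π b, b - π b), ?_, ?_⟩
  · simpa [hπx] using hp.2
  · exact (hπ.prodMk (contDiffOn_id.sub hπ)).mono Set.inter_subset_left
  · rintro b ⟨hb, hlt⟩
    have hL : lagrangeMap h (φ.symm (ι b)) = pairPoint b 0 := by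
      rw [← hφ, φ.right_inv hb]
    rw [← pairPoint_xPart (φ.symm (ι b))] at hL
    exact ⟨⟨mem_normalBundle_of_lagrangeMap_eq hL, sub_pos.1 hlt⟩, add_sub_cancel _ _⟩

theorem isTubularNeighborhood_image (hne : (realZeroSet h).Nonempty)
    (hrank : ∀ x ∈ realZeroSet h, (jac h x).rank = k) :
    IsTubularNeighborhood (realZeroSet h) ((fun p => p.1 + p.2) '' tubeBundle h) := by
  have hinj : Set.InjOn (fun p : EuclideanSpace ℝ (Fin n) × EuclideanSpace ℝ (Fin n) =>
      p.1 + p.2) (tubeBundle h) := fun p hp q hq hpq => eq_of_mem_tubeBundle hne hp hq hpq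
  refine ⟨?_, ?_, tubeRadius h, continuous_tubeRadius.continuousOn,
    fun x hx => tubeRadius_pos hrank hx, hinj.bijOn_image, ?_, ?_⟩
  · rw [isOpen_iff_mem_nhds]
    rintro _ ⟨p, hp, rfl⟩
    obtain ⟨O, hO, hpO, g, -, hg⟩ := exists_local_section hrank hp
    exact Filter.mem_of_superset (hO.mem_nhds hpO) fun b hb => ⟨g b, (hg b hb).1, (hg b hb).2⟩
  · intro x hx
    refine ⟨(x, 0), ⟨⟨hx, fun w _ => inner_zero_left _⟩, ?_⟩, add_zero x⟩
    simpa using tubeRadius_pos hrank hx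
  · exact fun p _ => ⟨Set.univ, isOpen_univ, Set.mem_univ _, _,
      (contDiff_fst.add contDiff_snd).contDiffOn, fun _ _ => rfl⟩
  · have hinv := hinj.bijOn_image.invOn_invFunOn
    refine ⟨_, hinv, ?_⟩
    rintro _ ⟨p, hp, rfl⟩
    obtain ⟨O, hO, hpO, g, hgs, hg⟩ := exists_local_section hrank hp
    refine ⟨O, hO, hpO, g, hgs, fun b hb => ?_⟩
    have h1 := hinv.1 (hg b hb.2).1
    simp only [(hg b hb.2).2] at h1
    exact h1

theorem complexPoint_eq (x : EuclideanSpace ℝ (Fin n)) (lam : Fin k → ℝ) :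
    complexPoint x lam = fun s => algebraMap ℝ ℂ (pairPoint x lam s) := by
  ext (i | j) <;> rfl

theorem aeval_algebraMap_comp {σ : Type*} (z : σ → ℝ) (p : MvPolynomial σ ℝ) :
    MvPolynomial.aeval (fun s => algebraMap ℝ ℂ (z s)) p =
      algebraMap ℝ ℂ (MvPolynomial.aeval z p) :=
  MvPolynomial.aeval_algebraMap_apply ℂ z p

theorem jacobian_algebraMap_comp {σ τ : Type*} (F : τ → MvPolynomial σ ℝ) (z : σ → ℝ) :
    jacobian F (fun s => algebraMap ℝ ℂ (z s)) = (jacobian F z).map (algebraMap ℝ ℂ) := by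
  ext j i
  exact aeval_algebraMap_comp z _

theorem isComplexZero_complexPoint {x b : EuclideanSpace ℝ (Fin n)} {lam : Fin k → ℝ}
    (hL : lagrangeMap h (pairPoint x lam) = pairPoint b 0) :
    IsComplexZero (lagrangeSystem h b) (complexPoint x lam) := by
  intro s
  rw [complexPoint_eq, aeval_algebraMap_comp]
  have h1 := congrFun hL s
  rcases s with i | j
  · have h2 : MvPolynomial.aeval (pairPoint x lam) (lagrangeSystem h 0 (Sum.inl i)) = b i := h1
    have h3 : lagrangeSystem h b (Sum.inl i) =
        lagrangeSystem h 0 (Sum.inl i) - MvPolynomial.C (b i) := by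
      simp [lagrangeSystem]
      ring
    rw [h3, map_sub, h2]
    simp
  · have h2 : MvPolynomial.aeval (pairPoint x lam) (lagrangeSystem h b (Sum.inr j)) = 0 := h1
    rw [h2, map_zero]

/-- A simple zero of a square polynomial system is isolated. -/
theorem IsSimpleZero.isIsolatedZero {σ : Type*} [Fintype σ] [DecidableEq σ]
    {F : σ → MvPolynomial σ ℝ} {z : σ → ℂ} (hz : IsSimpleZero F z) : IsIsolatedZero F z := by
  refine ⟨hz.1, ?_⟩
  obtain ⟨e, he⟩ := exists_equiv_of_det_ne_zero hz.2
  have hd : HasStrictFDerivAt (fun (z : σ → ℂ) (j : σ) => MvPolynomial.aeval z (F j))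
      (e : (σ → ℂ) →L[ℂ] (σ → ℂ)) z := by
    rw [he]
    exact hasStrictFDerivAt_polyMap F z
  let φ := hd.toOpenPartialHomeomorph
  refine ⟨φ.source, φ.open_source, hd.mem_toOpenPartialHomeomorph_source, fun z' hz' h0 => ?_⟩
  refine φ.injOn hz' hd.mem_toOpenPartialHomeomorph_source ?_
  exact funext fun j => (h0 j).trans (hz.1 j).symm

theorem isSimpleZero_complexPoint {x b : EuclideanSpace ℝ (Fin n)} {lam : Fin k → ℝ}
    (hL : lagrangeMap h (pairPoint x lam) = pairPoint b 0)
    (hdet : (jacobian (lagrangeSystem h 0) (pairPoint x lam)).det ≠ 0) :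
    IsSimpleZero (lagrangeSystem h b) (complexPoint x lam) := by
  refine ⟨isComplexZero_complexPoint hL, ?_⟩
  rw [jacobian_lagrangeSystem_eq, complexPoint_eq, jacobian_algebraMap_comp,
    ← RingHom.mapMatrix_apply, ← RingHom.map_det]
  simpa using hdet

/-- The multiplier of a complex Lagrange zero over a point with full rank Jacobian is unique. -/
theorem eq_of_isComplexZero {x b : EuclideanSpace ℝ (Fin n)} (hx : (jac h x).rank = k)
    {z z' : Fin n ⊕ Fin k → ℂ} (hz : IsComplexZero (lagrangeSystem h b) z)
    (hz' : IsComplexZero (lagrangeSystem h b) z') (hzx : ∀ i, z (Sum.inl i) = (x i : ℂ))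
    (hzx' : ∀ i, z' (Sum.inl i) = (x i : ℂ)) : z = z' := by
  have key : ∀ {z : Fin n ⊕ Fin k → ℂ}, IsComplexZero (lagrangeSystem h b) z →
      (∀ i, z (Sum.inl i) = (x i : ℂ)) →
      Matrix.vecMul (fun j => z (Sum.inr j)) ((jac h x).map (algebraMap ℝ ℂ)) =
        fun i => (x i : ℂ) - b i := by
    intro z hz hzx
    have hz0 : z ∘ Sum.inl = fun i => algebraMap ℝ ℂ (x i) := funext hzx
    ext i
    have h1 := hz (Sum.inl i)
    simp only [lagrangeSystem, Sum.elim_inl, map_sub, MvPolynomial.aeval_X, MvPolynomial.aeval_C,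
      map_sum, map_mul, MvPolynomial.aeval_rename, hz0, hzx, aeval_algebraMap_comp] at h1
    exact (sub_eq_zero.1 h1).symm
  have hG : IsUnit ((jac h x).map (algebraMap ℝ ℂ) *
      ((jac h x).transpose).map (algebraMap ℝ ℂ)) := by
    rw [← Matrix.map_mul, Matrix.isUnit_iff_isUnit_det, ← RingHom.mapMatrix_apply,
      ← RingHom.map_det]
    exact (isUnit_iff_ne_zero.2 (det_gram_ne_zero hx)).map _
  have h1 := (key hz hzx).trans (key hz' hzx').symm
  have h2 := congrArg (fun u => Matrix.vecMul u ((jac h x).transpose.map (algebraMap ℝ ℂ))) h1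
  simp only [Matrix.vecMul_vecMul] at h2
  have h3 := Matrix.vecMul_injective_iff_isUnit.2 hG h2
  ext (i | j)
  · rw [hzx, hzx']
  · exact congrFun h3 j

end TubularLagrange

theorem mainTheorem2 (n k : ℕ) (hkn : k < n) (h : Fin k → MvPolynomial (Fin n) ℝ)
    (hne : (realZeroSet h).Nonempty)
    (hrank : ∀ x ∈ realZeroSet h, (jacobian h (fun i => x i)).rank = k) :
    IsEmbeddedSubmanifold (n - k) (realZeroSet h) ∧
    ∃ U : Set (EuclideanSpace ℝ (Fin n)),
      IsTubularNeighborhood (realZeroSet h) U ∧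
      ∀ b ∈ U, ∃ xb : EuclideanSpace ℝ (Fin n),
        IsNearestPoint (realZeroSet h) b xb ∧
        (∀ y, IsNearestPoint (realZeroSet h) b y → y = xb) ∧
        ∃ lam : Fin k → ℝ,
          IsIsolatedZero (lagrangeSystem h b) (complexPoint xb lam) ∧
          IsSimpleZero (lagrangeSystem h b) (complexPoint xb lam) ∧
          ∀ z : Fin n ⊕ Fin k → ℂ, IsComplexZero (lagrangeSystem h b) z →
            (∀ i, z (Sum.inl i) = (xb i : ℂ)) → z = complexPoint xb lam := by
  refine ⟨isEmbeddedSubmanifold_realZeroSet hrank, _, isTubularNeighborhood_image hne hrank, ?_⟩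
  rintro _ ⟨⟨x, v⟩, hp, rfl⟩
  have hx : (jac h x).rank = k := hrank x hp.1.1
  have hreg := isRegularNormal_of_lt_tubeRadius hp.1 hp.2
  have hL := lagrangeMap_multiplier hx hp.1
  have hsimple := isSimpleZero_complexPoint hL hreg.2
  obtain ⟨y, hy⟩ := exists_isNearestPoint hne (x + v)
  refine ⟨x, hreg.1 y hy ▸ hy, hreg.1, multiplier h x v, hsimple.isIsolatedZero, hsimple, ?_⟩
  intro z hz hzx
  exact eq_of_isComplexZero hx hz hsimple.1 hzx fun i => rfl
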